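/- Theorem 3.1. For a constant $L>0$ and an integer $d\ge 1$, let $\mathcal P_0$ be the class of all probability densities $p$ on $\mathbb R^d$ (with respect to Lebesgue measure) with $\|p\|_\infty\le L$. Let $\|\cdot\|$ be the $L_2(\mathbb R^d)$ norm. An estimator $T_n$ is a real-valued function $T_n(x;X_1,\dots,X_n)$, jointly measurable in $x\in\mathbb R^d$ and in the sample $(X_1,\dots,X_n)\in(\mathbb R^d)^n$, and its risk is $R_n(T_n,p)=E_p^n\|T_n-p\|^2\in[0,\infty]$, where under $E_p^n$ the variables $X_1,\dots,X_n$ are i.i.d. with density $p$. For every $c_0>0$ there is a constant $c>0$, depending only on $c_0$, such that the following holds for all integers $d\ge 1$, $M\ge 2$, $n\ge 1$ with $M\le c_0 n$ and all $L>0$: there exist probability densities $p_1,\dots,p_M\in L_2(\mathbb R^d)$ such that $$\inf_{T_n}\ \sup_{p\in\mathcal P_0}\Big[R_n(T_n,p)-\inf_{\lambda\in\mathbb R^M}\Big\|\sum_{j=1}^M\lambda_jp_j-p\Big\|^2\Big]\ \ge\ c\,\frac{LM}{n},$$ where the first infimum is over all estimators $T_n$; that is, for every estimator $T_n$ the supremum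 is at least $cLM/n$. -/

import Mathlib

open MeasureTheory
open scoped ENNReal

noncomputable section

namespace DensityAggregation

/-- The sample space `ℝ^d`. Only its Borel structure and Lebesgue measure `volume` are used, never a
norm on it. -/
abbrev Space (d : ℕ) : Type := Fin d → ℝ

/-- `p` is a probability density with respect to Lebesgue measure on `ℝ^d`. -/
structure IsDensity {d : ℕ} (p : Space d → ℝ) : Prop where
  measurable : Measurable p
  nonneg : ∀ x, 0 ≤ p x
  integral_eq_one : ∫ x, p x = 1

/-- The class `𝒫₀` of probability densities `p` on `ℝ^d` with `‖p‖_∞ ≤ L`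
(essential supremum norm). -/
def boundedDensities (d : ℕ) (L : ℝ) : Set (Space d → ℝ) :=
  {p | IsDensity p ∧ eLpNorm p ∞ volume ≤ ENNReal.ofReal L}

/-- The squared `L₂(ℝ^d)` distance `‖f - g‖²`, with values in `[0, ∞]`. -/
def sqDist {d : ℕ} (f g : Space d → ℝ) : ℝ≥0∞ :=
  eLpNorm (fun x => f x - g x) 2 volume ^ 2

/-- The law `P_p^n` of an i.i.d. sample `(X_1, …, X_n)` from the density `p`. -/
def sampleLaw {d : ℕ} (n : ℕ) (p : Space d → ℝ) : Measure (Fin n → Space d) :=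
  Measure.pi fun _ => volume.withDensity fun x => ENNReal.ofReal (p x)

/-- An estimator of a density on `ℝ^d` from a sample of size `n`: it maps the sample
`X = (X_1, …, X_n)` to a function `x ↦ T X x`, and is a measurable function of `(X, x)`.
No integrability is required; an estimator which is not square integrable may have
infinite risk. -/
def IsEstimator {d n : ℕ} (T : (Fin n → Space d) → Space d → ℝ) : Prop :=
  Measurable fun z : (Fin n → Space d) × Space d => T z.1 z.2

/-- The risk `R_n(T, p) = E_p^n ‖T - p‖²`, with values in `[0, ∞]`. -/
def risk {d n : ℕ} (T : (Fin n → Space d) → Space d → ℝ) (p : Space d → ℝ) : ℝ≥0∞ :=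
  ∫⁻ X, sqDist (T X) p ∂(sampleLaw n p)

/-- The linear combination `p_lam = ∑ j, lam_j p_j`. -/
def linComb {d M : ℕ} (q : Fin M → Space d → ℝ) (lam : Fin M → ℝ) : Space d → ℝ :=
  fun x => ∑ j, lam j * q j x

/-- The excess risk `R_n(T, p) - inf_{lam ∈ ℝ^M} ‖p_lam - p‖²`. The infimum is finite whenever `p`
is square integrable, so the difference is then an honest one in `(-∞, ∞]`. -/
def excessRisk {d n M : ℕ} (q : Fin M → Space d → ℝ) (T : (Fin n → Space d) → Space d → ℝ)
    (p : Space d → ℝ) : EReal :=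
  (risk T p : EReal) - ((⨅ lam : Fin M → ℝ, sqDist (linComb q lam) p : ℝ≥0∞) : EReal)

end DensityAggregation

end

namespace DensityAggregation

/-! The bound is Assouad's lemma on a cube of densities lying in the span of the dictionary. With `K
= M - 1`, take `2K` disjoint cells of volume `1/(LK)`, grouped in `K` pairs. Starting from the
uniform density `L/2`, a sign vector `ω` tilts each pair to `L/2 (1 ± γ)`. These densities are
bounded by `L` and are linear combinations of the uniform density and `K` single-pair tilts
(`cubeValue_mem_span`), so the oracle term vanishes and only the risk has to be bounded below.

Flipping one sign changes the density by `Lγ` in absolute value on a pair of cells of total volume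
`2/(LK)`, while the affinity of the two sample laws is at least `(1 - γ²/K)^n ≥ 3/4` when `nγ² ≤
K/4`. So the two errors on that pair add up to at least `Lγ²/(2K)` (`two_point_bound`). Summing over
the pairs and averaging over `ω` gives risk at least `Lγ²/4` at some vertex (`exists_risk_ge`); `γ²`
of order `K/n` yields the rate `LM/n`. -/

/-! ### Product integrals and product densities -/

/-- The Lebesgue integral of a product of functions of separate coordinates factorizes. -/
theorem lintegral_pi_prod {α : Type*} [MeasurableSpace α] (μ : Measure α) [SigmaFinite μ] :
    ∀ (n : ℕ) (f : Fin n → α → ℝ≥0∞), (∀ i, Measurable (f i)) →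
      ∫⁻ X, ∏ i, f i (X i) ∂(Measure.pi fun _ : Fin n => μ) = ∏ i, ∫⁻ x, f i x ∂μ
  | 0, f, _ => by simp
  | n + 1, f, hf => by
    have hm := (measurePreserving_piFinSuccAbove (fun _ : Fin (n + 1) => μ) 0).symm
    rw [← hm.lintegral_comp_emb (MeasurableEquiv.measurableEmbedding _)]
    have h : ∀ z : α × (Fin n → α), (∏ i, f i
        ((MeasurableEquiv.piFinSuccAbove (fun _ : Fin (n + 1) => α) 0).symm z i)) =
        f 0 z.1 * ∏ i : Fin n, f i.succ (z.2 i) := by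
      intro z
      rw [Fin.prod_univ_succ]
      simp [MeasurableEquiv.piFinSuccAbove_symm_apply, Fin.insertNthEquiv]
    simp_rw [h]
    have hm2 : Measurable fun X : Fin n → α => ∏ i : Fin n, f i.succ (X i) :=
      Finset.measurable_prod _ fun i _ => (hf i.succ).comp (measurable_pi_apply i)
    rw [lintegral_prod_mul (hf 0).aemeasurable hm2.aemeasurable,
      lintegral_pi_prod μ n (fun i => f i.succ) fun i => hf i.succ, Fin.prod_univ_succ]

theorem pi_withDensity {α : Type*} [MeasurableSpace α] (μ : Measure α) [SigmaFinite μ] (n : ℕ)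
    {f : α → ℝ≥0∞} (hf : Measurable f) [SigmaFinite (μ.withDensity f)] :
    (Measure.pi fun _ : Fin n => μ.withDensity f) =
      (Measure.pi fun _ : Fin n => μ).withDensity fun X => ∏ i, f (X i) := by
  refine Measure.pi_eq fun s hs => ?_
  rw [withDensity_apply _ (MeasurableSet.univ_pi hs), ← lintegral_indicator
    (MeasurableSet.univ_pi hs)]
  have h : ∀ X : Fin n → α, (Set.univ.pi s).indicator (fun X => ∏ i, f (X i)) X =
      ∏ i, (s i).indicator f (X i) := by
    intro X
    by_cases hX : X ∈ Set.univ.pi s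
    · rw [Set.indicator_of_mem hX]
      exact Finset.prod_congr rfl fun i _ => (Set.indicator_of_mem (hX i trivial) _).symm
    · rw [Set.indicator_of_notMem hX]
      simp only [Set.mem_pi, Set.mem_univ, true_implies, not_forall] at hX
      obtain ⟨i, hi⟩ := hX
      exact (Finset.prod_eq_zero (Finset.mem_univ i) (Set.indicator_of_notMem hi _)).symm
  simp_rw [h]
  rw [lintegral_pi_prod μ n (fun i => (s i).indicator f) fun i => hf.indicator (hs i)]
  refine Finset.prod_congr rfl fun i _ => ?_
  rw [lintegral_indicator (hs i), withDensity_apply _ (hs i)]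

/-! ### Two-point lower bound -/

/-- Minimising over `x` leaves `(a - b)² fg/(f + g)`, and `fg/(f + g) ≥ u²/(f + g) ≥ u - (f + g)/4`
by AM-GM. The proof avoids division by completing the square after multiplying by `f + g`. Being
linear in `f`, `g`, `u`, the bound can be integrated directly. -/
theorem two_point_inequality {f g u : ℝ} (hf : 0 ≤ f) (hg : 0 ≤ g) (hu : 0 ≤ u)
    (hfg : u ^ 2 ≤ f * g) (a b x : ℝ) :
    (a - b) ^ 2 * u ≤
      (x - a) ^ 2 * f + (x - b) ^ 2 * g + (a - b) ^ 2 / 4 * (f + g) := by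
  obtain ⟨y, rfl⟩ : ∃ y, a = x + y := ⟨a - x, by ring⟩
  obtain ⟨z, rfl⟩ : ∃ z, b = x + z := ⟨b - x, by ring⟩
  have hdet : 0 ≤ f * g + ((f + g) / 4 - u) * (f + g) := by
    nlinarith [sq_nonneg (u - (f + g) / 2)]
  have key : 0 ≤ y ^ 2 * f + z ^ 2 * g + (y - z) ^ 2 * ((f + g) / 4 - u) := by
    set s := (f + g) / 4 - u with hs
    rcases le_or_gt 0 s with h0 | h0
    · positivity
    · have hpos : 0 < f + g := by
        by_contra hc
        have : f + g = 0 := by linarith [add_nonneg hf hg]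
        have hf0 : f = 0 := by linarith
        have : u = 0 := by nlinarith
        linarith
      have e : (f + g) * (y ^ 2 * f + z ^ 2 * g + (y - z) ^ 2 * s) =
          (y * f + z * g) ^ 2 + (y - z) ^ 2 * (f * g + s * (f + g)) := by ring
      have : 0 ≤ (f + g) * (y ^ 2 * f + z ^ 2 * g + (y - z) ^ 2 * s) := by
        rw [e]; positivity
      exact nonneg_of_mul_nonneg_right this hpos
  nlinarith [key]

/-- Two-point bound: if the sample has density `f` or `g`, no estimator can approximate both `p`
and `p'` well on a set on which they differ by `δ`. -/
theorem two_point_bound {Ω X : Type*} [MeasurableSpace Ω] [MeasurableSpace X]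
    (P : Measure Ω) (ν : Measure X) [SFinite ν] {f g u : Ω → ℝ}
    (hfm : Measurable f) (hgm : Measurable g) (hum : Measurable u)
    (hf : ∀ z, 0 ≤ f z) (hg : ∀ z, 0 ≤ g z) (hu : ∀ z, 0 ≤ u z) (hfg : ∀ z, u z ^ 2 ≤ f z * g z)
    (hf1 : ∫⁻ z, ENNReal.ofReal (f z) ∂P = 1) (hg1 : ∫⁻ z, ENNReal.ofReal (g z) ∂P = 1)
    {T : Ω → X → ℝ} (hT : Measurable fun z : Ω × X => T z.1 z.2) {p p' : X → ℝ}
    (hp : Measurable p) (hp' : Measurable p') {B : Set X} (hB : MeasurableSet B) (hBfin : ν B ≠ ∞)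
    {D : ℝ} (hD : ∀ x ∈ B, (p x - p' x) ^ 2 = D) (hD0 : 0 ≤ D)
    (hu34 : ENNReal.ofReal (3 / 4) ≤ ∫⁻ z, ENNReal.ofReal (u z) ∂P) :
    ν B * ENNReal.ofReal (D / 4) ≤
      ∫⁻ z, ENNReal.ofReal (f z) * ∫⁻ x in B, ENNReal.ofReal ((T z x - p x) ^ 2) ∂ν ∂P +
      ∫⁻ z, ENNReal.ofReal (g z) * ∫⁻ x in B, ENNReal.ofReal ((T z x - p' x) ^ 2) ∂ν ∂P := by
  have hmz : ∀ q : X → ℝ, Measurable q → Measurable fun z : Ω × X =>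
      ENNReal.ofReal ((T z.1 z.2 - q z.2) ^ 2) := fun q hq =>
    ((hT.sub (hq.comp measurable_snd)).pow_const 2).ennreal_ofReal
  have hm1 : ∀ q : X → ℝ, Measurable q → Measurable fun z : Ω =>
      ∫⁻ x in B, ENNReal.ofReal ((T z x - q x) ^ 2) ∂ν := fun q hq =>
    (hmz q hq).lintegral_prod_right'
  have hm2 : ∀ q : X → ℝ, Measurable q → ∀ z, Measurable fun x : X =>
      ENNReal.ofReal ((T z x - q x) ^ 2) := fun q hq z =>
    (hmz q hq).comp measurable_prodMk_left
  have pointwise : ∀ z, ν B * ENNReal.ofReal D * ENNReal.ofReal (u z) ≤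
      (ENNReal.ofReal (f z) * ∫⁻ x in B, ENNReal.ofReal ((T z x - p x) ^ 2) ∂ν +
        ENNReal.ofReal (g z) * ∫⁻ x in B, ENNReal.ofReal ((T z x - p' x) ^ 2) ∂ν) +
        ν B * ENNReal.ofReal (D / 4) * (ENNReal.ofReal (f z) + ENNReal.ofReal (g z)) := by
    intro z
    rw [← lintegral_const_mul _ (hm2 p hp z), ← lintegral_const_mul _ (hm2 p' hp' z),
      ← lintegral_add_left ((hm2 p hp z).const_mul _)]
    have e1 : ν B * ENNReal.ofReal D * ENNReal.ofReal (u z) =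
        ∫⁻ _ in B, ENNReal.ofReal D * ENNReal.ofReal (u z) ∂ν := by
      rw [setLIntegral_const]; ring
    have e2 : ν B * ENNReal.ofReal (D / 4) * (ENNReal.ofReal (f z) + ENNReal.ofReal (g z)) =
        ∫⁻ _ in B, ENNReal.ofReal (D / 4) * (ENNReal.ofReal (f z) + ENNReal.ofReal (g z)) ∂ν := by
      rw [setLIntegral_const]; ring
    rw [e1, e2, ← lintegral_add_right _ measurable_const]
    refine setLIntegral_mono' hB fun x hx => ?_
    rw [← ENNReal.ofReal_mul hD0, ← ENNReal.ofReal_mul (hf z), ← ENNReal.ofReal_mul (hg z),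
      ← ENNReal.ofReal_add (hf z) (hg z), ← ENNReal.ofReal_mul (by positivity),
      ← ENNReal.ofReal_add (mul_nonneg (hf z) (sq_nonneg _)) (mul_nonneg (hg z) (sq_nonneg _)),
      ← ENNReal.ofReal_add (add_nonneg (mul_nonneg (hf z) (sq_nonneg _))
        (mul_nonneg (hg z) (sq_nonneg _))) (mul_nonneg (by positivity) (add_nonneg (hf z) (hg z)))]
    apply ENNReal.ofReal_le_ofReal
    have := two_point_inequality (hf z) (hg z) (hu z) (hfg z) (p x) (p' x) (T z x)
    rw [hD x hx] at this
    linarith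
  have hint := lintegral_mono (μ := P) pointwise
  have hm3 : Measurable fun z => ENNReal.ofReal (f z) + ENNReal.ofReal (g z) :=
    hfm.ennreal_ofReal.add hgm.ennreal_ofReal
  have hm4 : Measurable fun z => ENNReal.ofReal (f z) *
      ∫⁻ x in B, ENNReal.ofReal ((T z x - p x) ^ 2) ∂ν := hfm.ennreal_ofReal.mul (hm1 p hp)
  rw [lintegral_const_mul _ hum.ennreal_ofReal, lintegral_add_right _ (hm3.const_mul _),
    lintegral_add_left hm4, lintegral_const_mul _ hm3, lintegral_add_left hfm.ennreal_ofReal,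
    hf1, hg1] at hint
  -- Affinity `3/4` leaves `3/4 - 2 · 1/4 = 1/4` of `D` once the two total masses are paid for.
  have hlow : ν B * ENNReal.ofReal (D / 4) + ν B * ENNReal.ofReal (D / 4) * (1 + 1) ≤
      ν B * ENNReal.ofReal D * ∫⁻ z, ENNReal.ofReal (u z) ∂P := by
    refine le_trans (le_of_eq ?_) (mul_le_mul_right hu34 _)
    rw [mul_assoc, mul_assoc, ← mul_add, ← ENNReal.ofReal_mul hD0]
    congr 1
    have : (1 + 1 : ℝ≥0∞) = ENNReal.ofReal 2 := by norm_num
    rw [this, ← ENNReal.ofReal_mul (by positivity), ← ENNReal.ofReal_add (by positivity)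
      (by positivity)]
    congr 1; ring
  have hfin : ν B * ENNReal.ofReal (D / 4) * (1 + 1) ≠ ∞ := by
    finiteness
  exact (ENNReal.add_le_add_iff_right hfin).1 (hlow.trans hint)

/-! ### Cells and step densities -/

/-- Pairwise disjoint cells of prescribed volume. -/
theorem exists_disjoint_cells {d : ℕ} (hd : 1 ≤ d) (ι : Type*) [Fintype ι] {w : ℝ} (hw : 0 ≤ w) :
    ∃ A : ι → Set (Space d), (∀ i, MeasurableSet (A i)) ∧ (∀ i, volume (A i) = ENNReal.ofReal w) ∧
      Pairwise fun i j => Disjoint (A i) (A j) := by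
  obtain ⟨e, rfl⟩ := Nat.exists_eq_add_of_le' hd
  let N : ι → ℕ := fun i => (Fintype.equivFin ι i : ℕ)
  have hN : Function.Injective N := Fin.val_injective.comp (Fintype.equivFin ι).injective
  -- Consecutive slabs of width `w` in the first coordinate, with unit sides in the others.
  let lo : ι → Space (e + 1) := fun i => Fin.cons (N i * w) fun _ => 0
  let hi : ι → Space (e + 1) := fun i => Fin.cons ((N i + 1) * w) fun _ => 1
  refine ⟨fun i => Set.univ.pi fun k => Set.Ico (lo i k) (hi i k),
    fun i => MeasurableSet.univ_pi fun k => measurableSet_Ico, fun i => ?_, ?_⟩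
  · rw [Real.volume_pi_Ico, Fin.prod_univ_succ]
    simp only [lo, hi, Fin.cons_zero, Fin.cons_succ, sub_zero, ENNReal.ofReal_one,
      Finset.prod_const_one, mul_one]
    congr 1; ring
  · have key : ∀ i j, N i < N j → Disjoint (Set.univ.pi fun k => Set.Ico (lo i k) (hi i k))
        (Set.univ.pi fun k => Set.Ico (lo j k) (hi j k)) := by
      intro i j hij
      rw [Set.disjoint_left]
      intro x hx hx'
      have h1 := (hx 0 trivial).2
      have h2 := (hx' 0 trivial).1
      simp only [lo, hi, Fin.cons_zero] at h1 h2
      have h3 : (N i : ℝ) + 1 ≤ N j := by exact_mod_cast hij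
      nlinarith [mul_le_mul_of_nonneg_right h3 hw]
    intro i j hij
    rcases lt_or_gt_of_ne (hN.ne hij) with h | h
    · exact key i j h
    · exact (key j i h).symm

section Step

variable {X ι : Type*} [Fintype ι]

/-- The step function with value `a i` on the cell `A i`. -/
noncomputable def step (A : ι → Set X) (a : ι → ℝ) (x : X) : ℝ :=
  ∑ i, (A i).indicator (fun _ => a i) x

theorem step_of_mem {A : ι → Set X} (hA : Pairwise fun i j => Disjoint (A i) (A j)) (a : ι → ℝ)
    {i : ι} {x : X} (hx : x ∈ A i) : step A a x = a i := by
  unfold step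
  rw [Finset.sum_eq_single i, Set.indicator_of_mem hx]
  · intro j _ hj
    exact Set.indicator_of_notMem (fun h => Set.disjoint_left.1 (hA hj) h hx) _
  · simp

theorem step_of_forall_notMem {A : ι → Set X} (a : ι → ℝ) {x : X} (hx : ∀ i, x ∉ A i) :
    step A a x = 0 :=
  Finset.sum_eq_zero fun i _ => Set.indicator_of_notMem (hx i) _

theorem sum_mul_step {κ : Type*} [Fintype κ] (A : ι → Set X) (c : κ → ℝ) (a : κ → ι → ℝ) (x : X) :
    ∑ k, c k * step A (a k) x = step A (fun i => ∑ k, c k * a k i) x := by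
  simp only [step, Finset.mul_sum]
  rw [Finset.sum_comm]
  refine Finset.sum_congr rfl fun i _ => ?_
  by_cases hx : x ∈ A i <;> simp [hx]

theorem step_nonneg (A : ι → Set X) {a : ι → ℝ} (ha : ∀ i, 0 ≤ a i) (x : X) : 0 ≤ step A a x :=
  Finset.sum_nonneg fun i _ => Set.indicator_nonneg (fun _ _ => ha i) x

variable [MeasurableSpace X] {μ : Measure X} {A : ι → Set X} {w : ℝ}

theorem measurable_step (hA : ∀ i, MeasurableSet (A i)) (a : ι → ℝ) : Measurable (step A a) :=
  Finset.measurable_fun_sum _ fun i _ => measurable_const.indicator (hA i)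

theorem lintegral_step (hA : ∀ i, MeasurableSet (A i)) (hw : 0 ≤ w)
    (hμ : ∀ i, μ (A i) = ENNReal.ofReal w) {a : ι → ℝ} (ha : ∀ i, 0 ≤ a i) :
    ∫⁻ x, ENNReal.ofReal (step A a x) ∂μ = ENNReal.ofReal (w * ∑ i, a i) := by
  have h : ∀ x, ENNReal.ofReal (step A a x) =
      ∑ i, (A i).indicator (fun _ => ENNReal.ofReal (a i)) x := by
    intro x
    unfold step
    rw [ENNReal.ofReal_sum_of_nonneg fun i _ => Set.indicator_nonneg (fun _ _ => ha i) x]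
    refine Finset.sum_congr rfl fun i _ => ?_
    by_cases hx : x ∈ A i <;> simp [hx]
  simp_rw [h]
  rw [lintegral_finsetSum _ fun i _ => measurable_const.indicator (hA i), Finset.mul_sum,
    ENNReal.ofReal_sum_of_nonneg fun i _ => mul_nonneg hw (ha i)]
  refine Finset.sum_congr rfl fun i _ => ?_
  rw [lintegral_indicator_const (hA i), hμ, ENNReal.ofReal_mul hw, mul_comm]

theorem integral_step (hA : ∀ i, MeasurableSet (A i)) (hw : 0 ≤ w)
    (hμ : ∀ i, μ (A i) = ENNReal.ofReal w) {a : ι → ℝ} (ha : ∀ i, 0 ≤ a i) :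
    ∫ x, step A a x ∂μ = w * ∑ i, a i := by
  rw [integral_eq_lintegral_of_nonneg_ae (.of_forall (step_nonneg A ha))
    (measurable_step hA a).aestronglyMeasurable, lintegral_step hA hw hμ ha,
    ENNReal.toReal_ofReal (mul_nonneg hw (Finset.sum_nonneg fun i _ => ha i))]

theorem memLp_step (hA : ∀ i, MeasurableSet (A i)) (hμ : ∀ i, μ (A i) = ENNReal.ofReal w)
    (a : ι → ℝ) (p : ℝ≥0∞) : MemLp (step A a) p μ :=
  memLp_finsetSum _ fun i _ => memLp_indicator_const p (hA i) (a i)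
    (Or.inr (by rw [hμ]; exact ENNReal.ofReal_ne_top))

end Step

theorem isDensity_step {d : ℕ} {ι : Type*} [Fintype ι] {A : ι → Set (Space d)} {w : ℝ}
    (hA : ∀ i, MeasurableSet (A i)) (hw : 0 ≤ w) (hvol : ∀ i, volume (A i) = ENNReal.ofReal w)
    {a : ι → ℝ} (ha : ∀ i, 0 ≤ a i) (hsum : w * ∑ i, a i = 1) : IsDensity (step A a) :=
  ⟨measurable_step hA a, step_nonneg A ha, (integral_step hA hw hvol ha).trans hsum⟩

theorem step_mem_boundedDensities {d : ℕ} {ι : Type*} [Fintype ι] {A : ι → Set (Space d)}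
    {w L : ℝ} (hA : ∀ i, MeasurableSet (A i)) (hdisj : Pairwise fun i j => Disjoint (A i) (A j))
    (hw : 0 ≤ w) (hvol : ∀ i, volume (A i) = ENNReal.ofReal w) {a : ι → ℝ} (ha : ∀ i, 0 ≤ a i)
    (hL : 0 ≤ L) (haL : ∀ i, a i ≤ L) (hsum : w * ∑ i, a i = 1) :
    step A a ∈ boundedDensities d L := by
  refine ⟨isDensity_step hA hw hvol ha hsum, ?_⟩
  rw [eLpNorm_exponent_top]
  refine eLpNormEssSup_le_of_ae_bound (.of_forall fun x => ?_)
  rw [Real.norm_of_nonneg (step_nonneg A ha x)]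
  by_cases hx : ∃ i, x ∈ A i
  · obtain ⟨i, hi⟩ := hx
    rw [step_of_mem hdisj a hi]
    exact haL i
  · rw [step_of_forall_notMem a (not_exists.1 hx)]
    exact hL

/-! ### Risk as an integral -/

theorem sqDist_eq_lintegral {d : ℕ} (f g : Space d → ℝ) :
    sqDist f g = ∫⁻ x, ENNReal.ofReal ((f x - g x) ^ 2) := by
  have h := eLpNorm_nnreal_pow_eq_lintegral (μ := volume) (f := fun x : Space d => f x - g x)
    (p := 2) two_ne_zero
  norm_num at h
  rw [sqDist, h]
  refine lintegral_congr fun x => ?_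
  rw [← ofReal_norm, ← ENNReal.ofReal_pow (norm_nonneg _), Real.norm_eq_abs, sq_abs]

/-- Moving the density into the integrand puts the risks under different densities over one common
measure, as the two-point bound requires. -/
theorem risk_eq_lintegral {d n : ℕ} {T : (Fin n → Space d) → Space d → ℝ} (hT : IsEstimator T)
    {p : Space d → ℝ} (hp : Measurable p) (hp0 : ∀ x, 0 ≤ p x) :
    risk T p = ∫⁻ X, ENNReal.ofReal (∏ i, p (X i)) *
      (∫⁻ x, ENNReal.ofReal ((T X x - p x) ^ 2)) ∂(Measure.pi fun _ : Fin n => volume) := by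
  have hm : Measurable fun X : Fin n → Space d =>
      ∫⁻ x, ENNReal.ofReal ((T X x - p x) ^ 2) :=
    Measurable.lintegral_prod_right' (f := fun z : (Fin n → Space d) × Space d =>
      ENNReal.ofReal ((T z.1 z.2 - p z.2) ^ 2))
      ((Measurable.sub hT (hp.comp measurable_snd)).pow_const 2).ennreal_ofReal
  have hprod : ∀ X : Fin n → Space d,
      ∏ i, ENNReal.ofReal (p (X i)) = ENNReal.ofReal (∏ i, p (X i)) := fun X =>
    (ENNReal.ofReal_prod_of_nonneg fun i _ => hp0 _).symm
  unfold risk sampleLaw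
  simp_rw [sqDist_eq_lintegral]
  have hpm : Measurable fun X : Fin n → Space d => ∏ i, ENNReal.ofReal (p (X i)) :=
    Finset.measurable_fun_prod _ fun i _ => hp.ennreal_ofReal.comp (measurable_pi_apply i)
  rw [pi_withDensity volume n hp.ennreal_ofReal, lintegral_withDensity_eq_lintegral_mul _ hpm hm]
  simp only [Pi.mul_apply, hprod]

/-! ### The hypercube of densities -/

/-- The sign `±1` attached to a Boolean. -/
def boolSign (b : Bool) : ℝ := if b then 1 else -1

theorem boolSign_sq (b : Bool) : boolSign b ^ 2 = 1 := by cases b <;> simp [boolSign]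

theorem boolSign_not (b : Bool) : boolSign (!b) = -boolSign b := by cases b <;> simp [boolSign]

/-- The values of the density attached to the vertex `ω` of the hypercube. -/
noncomputable def cubeValue {K : ℕ} (L γ : ℝ) (ω : Fin K → Bool) (i : Fin K × Bool) : ℝ :=
  L / 2 * (1 + γ * boolSign (ω i.1) * boolSign i.2)

/-- The values of a function whose square is at most the product of the densities attached to `ω`
and to its neighbour in direction `j`. -/
noncomputable def affinityValue {K : ℕ} (L γ : ℝ) (ω : Fin K → Bool) (j : Fin K)
    (i : Fin K × Bool) : ℝ :=
  if i.1 = j then L / 2 * (1 - γ ^ 2) else cubeValue L γ ω i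

/-- The neighbour of `ω` in direction `j`. -/
def flip {K : ℕ} (j : Fin K) (ω : Fin K → Bool) : Fin K → Bool := Function.update ω j (!ω j)

theorem flip_involutive {K : ℕ} (j : Fin K) : Function.Involutive (flip j) := fun ω => by
  simp [flip]

section Cube

variable {K : ℕ} {L γ : ℝ}

theorem abs_mul_boolSign_le (hγ0 : 0 ≤ γ) (hγ1 : γ ≤ 1) (b c : Bool) :
    -1 ≤ γ * boolSign b * boolSign c ∧ γ * boolSign b * boolSign c ≤ 1 := by
  cases b <;> cases c <;> simp [boolSign] <;> constructor <;> linarith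

theorem cubeValue_nonneg (hL : 0 ≤ L) (hγ0 : 0 ≤ γ) (hγ1 : γ ≤ 1) (ω : Fin K → Bool)
    (i : Fin K × Bool) : 0 ≤ cubeValue L γ ω i := by
  have := (abs_mul_boolSign_le hγ0 hγ1 (ω i.1) i.2).1
  exact mul_nonneg (by linarith) (by linarith)

theorem cubeValue_le (hL : 0 ≤ L) (hγ0 : 0 ≤ γ) (hγ1 : γ ≤ 1) (ω : Fin K → Bool)
    (i : Fin K × Bool) : cubeValue L γ ω i ≤ L := by
  have := (abs_mul_boolSign_le hγ0 hγ1 (ω i.1) i.2).2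
  unfold cubeValue
  nlinarith

theorem affinityValue_nonneg (hL : 0 ≤ L) (hγ0 : 0 ≤ γ) (hγ1 : γ ≤ 1) (ω : Fin K → Bool)
    (j : Fin K) (i : Fin K × Bool) : 0 ≤ affinityValue L γ ω j i := by
  unfold affinityValue
  split_ifs
  · exact mul_nonneg (by linarith) (by nlinarith)
  · exact cubeValue_nonneg hL hγ0 hγ1 ω i

theorem cubeValue_flip_of_ne (ω : Fin K → Bool) {j : Fin K} {i : Fin K × Bool} (h : i.1 ≠ j) :
    cubeValue L γ (flip j ω) i = cubeValue L γ ω i := by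
  simp [cubeValue, flip, h]

theorem cubeValue_flip_self (ω : Fin K → Bool) (j : Fin K) (b : Bool) :
    cubeValue L γ (flip j ω) (j, b) = L / 2 * (1 - γ * boolSign (ω j) * boolSign b) := by
  simp only [cubeValue, flip, Function.update_self, boolSign_not]
  ring

/-- On the flipped pair the product is `(L/2)² (1 - γ²)`, and `(1 - γ²)² ≤ 1 - γ²`. Using `1 - γ²`
instead of its square root keeps the affinity integral polynomial in `γ`. -/
theorem affinityValue_sq_le (hγ0 : 0 ≤ γ) (hγ1 : γ ≤ 1) (ω : Fin K → Bool)
    (j : Fin K) (i : Fin K × Bool) :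
    affinityValue L γ ω j i ^ 2 ≤ cubeValue L γ ω i * cubeValue L γ (flip j ω) i := by
  obtain ⟨k, b⟩ := i
  unfold affinityValue
  split_ifs with h
  · obtain rfl : k = j := h
    rw [cubeValue_flip_self]
    have e : cubeValue L γ ω (k, b) * (L / 2 * (1 - γ * boolSign (ω k) * boolSign b)) =
        (L / 2) ^ 2 * (1 - γ ^ 2 * boolSign (ω k) ^ 2 * boolSign b ^ 2) := by
      unfold cubeValue; ring
    rw [e, boolSign_sq, boolSign_sq, mul_pow]
    have hγ2 : γ ^ 2 ≤ 1 := by nlinarith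
    refine mul_le_mul_of_nonneg_left ?_ (sq_nonneg _)
    nlinarith [sq_nonneg γ]
  · rw [cubeValue_flip_of_ne ω h, sq]

theorem sq_cubeValue_sub_flip (ω : Fin K → Bool) (j : Fin K) (b : Bool) :
    (cubeValue L γ ω (j, b) - cubeValue L γ (flip j ω) (j, b)) ^ 2 = L ^ 2 * γ ^ 2 := by
  rw [cubeValue_flip_self, cubeValue]
  have e : (L / 2 * (1 + γ * boolSign (ω j) * boolSign b) -
      L / 2 * (1 - γ * boolSign (ω j) * boolSign b)) ^ 2 =
      L ^ 2 * γ ^ 2 * boolSign (ω j) ^ 2 * boolSign b ^ 2 := by ring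
  rw [e, boolSign_sq, boolSign_sq]; ring

theorem sum_cubeValue (ω : Fin K → Bool) : ∑ i, cubeValue L γ ω i = L * K := by
  rw [Fintype.sum_prod_type]
  have : ∀ k : Fin K, ∑ b, cubeValue L γ ω (k, b) = L := by
    intro k; simp [cubeValue, boolSign]; ring
  simp only [this]
  simp [mul_comm]

theorem sum_affinityValue (ω : Fin K → Bool) (j : Fin K) :
    ∑ i, affinityValue L γ ω j i = L * K - L * γ ^ 2 := by
  rw [Fintype.sum_prod_type]
  have : ∀ k : Fin K, ∑ b, affinityValue L γ ω j (k, b) = L - if k = j then L * γ ^ 2 else 0 := by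
    intro k
    by_cases h : k = j
    · simp [affinityValue, h]; ring
    · simp [affinityValue, h, cubeValue, boolSign]; ring
  simp only [this]
  simp [mul_comm]

/-! ### Assouad's argument -/

/-- Assouad's bound on the hypercube of step densities. -/
theorem exists_risk_ge {d n : ℕ} (hK : 0 < K) (hL : 0 < L) (hγ0 : 0 ≤ γ) (hγ1 : γ ≤ 1)
    (hn : n * γ ^ 2 ≤ K / 4) {A : Fin K × Bool → Set (Space d)}
    (hA : ∀ i, MeasurableSet (A i)) (hvol : ∀ i, volume (A i) = ENNReal.ofReal (1 / (L * K)))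
    (hdisj : Pairwise fun i j => Disjoint (A i) (A j))
    {T : (Fin n → Space d) → Space d → ℝ} (hT : IsEstimator T) :
    ∃ ω : Fin K → Bool, ENNReal.ofReal (L * γ ^ 2 / 4) ≤ risk T (step A (cubeValue L γ ω)) := by
  have hKr : (0 : ℝ) < K := by exact_mod_cast hK
  have hw : 0 ≤ 1 / (L * K) := by positivity
  let P : Measure (Fin n → Space d) := Measure.pi fun _ => volume
  let p : (Fin K → Bool) → Space d → ℝ := fun ω => step A (cubeValue L γ ω)
  let B : Fin K → Set (Space d) := fun j => A (j, true) ∪ A (j, false)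
  let f : (Fin K → Bool) → (Fin n → Space d) → ℝ := fun ω X => ∏ i, p ω (X i)
  let R : Fin K → (Fin K → Bool) → ℝ≥0∞ := fun j ω =>
    ∫⁻ X, ENNReal.ofReal (f ω X) * (∫⁻ x in B j, ENNReal.ofReal ((T X x - p ω x) ^ 2)) ∂P
  have hpm : ∀ ω, Measurable (p ω) := fun ω => measurable_step hA _
  have hc0 := fun ω => cubeValue_nonneg (K := K) hL.le hγ0 hγ1 ω
  have hp0 : ∀ ω x, 0 ≤ p ω x := fun ω => step_nonneg A (hc0 ω)
  have hprod_meas : ∀ q : Space d → ℝ, Measurable q →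
      Measurable fun X : Fin n → Space d => ∏ i, q (X i) := fun q hq =>
    Finset.measurable_fun_prod _ fun i _ => hq.comp (measurable_pi_apply i)
  have hprod_int : ∀ a : Fin K × Bool → ℝ, (∀ i, 0 ≤ a i) →
      ∫⁻ X, ENNReal.ofReal (∏ i, step A a (X i)) ∂P =
        ENNReal.ofReal ((1 / (L * K) * ∑ i, a i) ^ n) := by
    intro a ha
    simp_rw [ENNReal.ofReal_prod_of_nonneg fun i _ => step_nonneg A ha _]
    rw [lintegral_pi_prod volume n (fun _ x => ENNReal.ofReal (step A a x))
      fun _ => (measurable_step hA a).ennreal_ofReal, lintegral_step hA hw hvol ha,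
      Finset.prod_const, Finset.card_univ, Fintype.card_fin, ENNReal.ofReal_pow
      (mul_nonneg hw (Finset.sum_nonneg fun i _ => ha i))]
  have hf1 : ∀ ω, ∫⁻ X, ENNReal.ofReal (f ω X) ∂P = 1 := by
    intro ω
    rw [hprod_int _ (hc0 ω), sum_cubeValue, one_div_mul_cancel (by positivity), one_pow,
      ENNReal.ofReal_one]
  have hBm : ∀ j, MeasurableSet (B j) := fun j => (hA _).union (hA _)
  have hBvol : ∀ j, volume (B j) = ENNReal.ofReal (2 / (L * K)) := by
    intro j
    rw [measure_union (hdisj (by simp)) (hA _), hvol, hvol, ← ENNReal.ofReal_add hw hw]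
    congr 1; ring
  have hpair : ∀ j ω, ENNReal.ofReal (L * γ ^ 2 / (2 * K)) ≤ R j ω + R j (flip j ω) := by
    intro j ω
    have hu0 := affinityValue_nonneg (K := K) hL.le hγ0 hγ1 ω j
    have hpt : ∀ x, step A (affinityValue L γ ω j) x ^ 2 ≤ p ω x * p (flip j ω) x := by
      intro x
      by_cases hx : ∃ i, x ∈ A i
      · obtain ⟨i, hi⟩ := hx
        simp only [p, step_of_mem hdisj _ hi]
        exact affinityValue_sq_le hγ0 hγ1 ω j i
      · simp [p, step_of_forall_notMem _ (not_exists.1 hx)]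
    have hfinal := two_point_bound P volume (f := f ω) (g := f (flip j ω))
      (u := fun X => ∏ i, step A (affinityValue L γ ω j) (X i)) (T := T) (p := p ω)
      (p' := p (flip j ω)) (B := B j) (D := L ^ 2 * γ ^ 2)
      (hprod_meas _ (hpm _)) (hprod_meas _ (hpm _)) (hprod_meas _ (measurable_step hA _))
      (fun X => Finset.prod_nonneg fun i _ => hp0 _ _)
      (fun X => Finset.prod_nonneg fun i _ => hp0 _ _)
      (fun X => Finset.prod_nonneg fun i _ => step_nonneg A hu0 _)
      (fun X => by
        simp only [f]
        rw [← Finset.prod_pow, ← Finset.prod_mul_distrib]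
        exact Finset.prod_le_prod (fun i _ => sq_nonneg _) fun i _ => hpt _)
      (hf1 _) (hf1 _) hT (hpm _) (hpm _) (hBm j) (by rw [hBvol]; exact ENNReal.ofReal_ne_top)
      (fun x hx => by
        rcases hx with hx | hx <;>
        · simp only [p, step_of_mem hdisj _ hx]
          exact sq_cubeValue_sub_flip ω j _)
      (by positivity)
      (by
        rw [hprod_int _ hu0, sum_affinityValue]
        apply ENNReal.ofReal_le_ofReal
        have e : 1 / (L * K) * (L * K - L * γ ^ 2) = 1 + -(γ ^ 2 / K) := by
          field_simp; ring
        rw [e]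
        have h1 : γ ^ 2 / K ≤ 1 := by
          rw [div_le_one hKr]
          have : (1 : ℝ) ≤ K := by exact_mod_cast hK
          nlinarith
        -- Bernoulli's inequality bounds the affinity `(1 - γ²/K)^n` below by `1 - nγ²/K ≥ 3/4`.
        have h2 := one_add_mul_le_pow (a := -(γ ^ 2 / (K : ℝ))) (by linarith) n
        have h3 : n * (γ ^ 2 / K) ≤ 1 / 4 := by
          rw [← mul_div_assoc, div_le_iff₀ hKr]; linarith
        linarith)
    refine le_trans (le_of_eq ?_) hfinal
    rw [hBvol, ← ENNReal.ofReal_mul (by positivity)]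
    congr 1
    field_simp; ring
  have hrisk : ∀ ω, ∑ j, R j ω ≤ risk T (p ω) := by
    intro ω
    rw [risk_eq_lintegral hT (hpm ω) (hp0 ω)]
    have hm : ∀ j, Measurable fun X : Fin n → Space d => ENNReal.ofReal (f ω X) *
        ∫⁻ x in B j, ENNReal.ofReal ((T X x - p ω x) ^ 2) := fun j =>
      (hprod_meas _ (hpm ω)).ennreal_ofReal.mul (Measurable.lintegral_prod_right'
        (f := fun z : (Fin n → Space d) × Space d => ENNReal.ofReal ((T z.1 z.2 - p ω z.2) ^ 2))
        ((Measurable.sub hT ((hpm ω).comp measurable_snd)).pow_const 2).ennreal_ofReal)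
    rw [← lintegral_finsetSum _ fun j _ => hm j]
    refine lintegral_mono fun X => ?_
    rw [← Finset.mul_sum]
    refine mul_le_mul_right ?_ _
    have hBd : Pairwise fun i j => Disjoint (B i) (B j) := by
      intro i j hij
      simp only [B, Set.disjoint_union_left, Set.disjoint_union_right]
      refine ⟨⟨hdisj ?_, hdisj ?_⟩, hdisj ?_, hdisj ?_⟩ <;> simp [hij]
    rw [← tsum_fintype (L := .unconditional _), ← lintegral_iUnion hBm hBd]
    exact setLIntegral_le_lintegral _ _
  obtain ⟨ω₀, -, hω₀⟩ := Finset.exists_max_image Finset.univ (fun ω => risk T (p ω))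
    ⟨fun _ : Fin K => true, Finset.mem_univ _⟩
  refine ⟨ω₀, ?_⟩
  -- Flipping permutes the vertices, so each pair bound summed over `ω` counts every local risk
  -- twice.
  have hR : ∀ j, ∑ ω, R j (flip j ω) = ∑ ω, R j ω := fun j =>
    Equiv.sum_comp (flip_involutive j).toPerm (R j)
  have hsum : ∑ j : Fin K, ∑ _ω : Fin K → Bool, ENNReal.ofReal (L * γ ^ 2 / (2 * K)) ≤
      2 * ∑ ω, risk T (p ω) := by
    calc _ ≤ ∑ j, ∑ ω, (R j ω + R j (flip j ω)) :=
          Finset.sum_le_sum fun j _ => Finset.sum_le_sum fun ω _ => hpair j ω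
      _ = 2 * ∑ ω, ∑ j, R j ω := by
          rw [Finset.sum_comm (s := (Finset.univ : Finset (Fin K → Bool))), Finset.mul_sum]
          refine Finset.sum_congr rfl fun j _ => ?_
          rw [Finset.sum_add_distrib, hR, two_mul]
      _ ≤ _ := mul_le_mul_right (Finset.sum_le_sum fun ω _ => hrisk ω) _
  have hmax : ∑ ω, risk T (p ω) ≤ (Fintype.card (Fin K → Bool)) * risk T (p ω₀) := by
    simpa using Finset.sum_le_card_nsmul Finset.univ (fun ω => risk T (p ω)) _ hω₀
  have hcard0 : ((Fintype.card (Fin K → Bool) : ℕ) : ℝ≥0∞) ≠ 0 := by simp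
  have hKE : (K : ℝ≥0∞) = ENNReal.ofReal K := (ENNReal.ofReal_natCast K).symm
  have h2E : (2 : ℝ≥0∞) = ENNReal.ofReal 2 := by norm_num
  have hchain := hsum.trans (mul_le_mul_right hmax 2)
  simp only [Finset.sum_const, Finset.card_univ, Fintype.card_fin, nsmul_eq_mul] at hchain
  have hL2 : (K : ℝ≥0∞) * (((Fintype.card (Fin K → Bool) : ℕ) : ℝ≥0∞) *
      ENNReal.ofReal (L * γ ^ 2 / (2 * K))) = (2 * ((Fintype.card (Fin K → Bool) : ℕ) : ℝ≥0∞)) *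
      ENNReal.ofReal (L * γ ^ 2 / 4) := by
    rw [mul_left_comm, mul_comm (2 : ℝ≥0∞), mul_assoc, hKE, h2E,
      ← ENNReal.ofReal_mul hKr.le, ← ENNReal.ofReal_mul zero_le_two]
    congr 2
    field_simp; ring
  rw [hL2, ← mul_assoc] at hchain
  exact (ENNReal.mul_le_mul_iff_right (mul_ne_zero two_ne_zero hcard0)
    (ENNReal.mul_ne_top ENNReal.ofNat_ne_top (ENNReal.natCast_ne_top _))).1 hchain

/-! ### The dictionary and its span -/

/-- The values of the densities to be aggregated: a uniform density and one perturbation of it for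
each pair of cells. -/
noncomputable def dictionaryValue (L : ℝ) : Fin (K + 1) → Fin K × Bool → ℝ :=
  Fin.cons (fun _ => L / 2) fun j i => L / 2 * (1 + if i.1 = j then boolSign i.2 else 0)

theorem dictionaryValue_nonneg (hL : 0 ≤ L) (j : Fin (K + 1)) (i : Fin K × Bool) :
    0 ≤ dictionaryValue L j i := by
  have hL2 : 0 ≤ L / 2 := by linarith
  refine Fin.cases ?_ (fun j => ?_) j
  · exact hL2
  · refine mul_nonneg hL2 ?_
    obtain ⟨k, b⟩ := i
    split_ifs
    · cases b <;> simp [boolSign]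
    · norm_num

theorem sum_dictionaryValue (j : Fin (K + 1)) : ∑ i, dictionaryValue L j i = L * K := by
  rw [Fintype.sum_prod_type]
  refine Fin.cases ?_ (fun j => ?_) j
  · simp [dictionaryValue]; ring
  · have : ∀ k : Fin K, ∑ b, dictionaryValue L j.succ (k, b) = L := by
      intro k
      by_cases h : k = j <;> simp [dictionaryValue, h, boolSign] <;> ring
    simp only [this]
    simp [mul_comm]

theorem cubeValue_mem_span (ω : Fin K → Bool) :
    ∃ lam : Fin (K + 1) → ℝ, ∀ i, ∑ j, lam j * dictionaryValue L j i = cubeValue L γ ω i := by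
  -- Each tilt has weight `±γ`; the uniform density takes the rest so that the weights sum to one.
  refine ⟨Fin.cons (1 - ∑ j, γ * boolSign (ω j)) fun j => γ * boolSign (ω j), fun i => ?_⟩
  rw [Fin.sum_univ_succ]
  simp only [dictionaryValue, Fin.cons_zero, Fin.cons_succ, cubeValue]
  have h : ∀ j : Fin K, γ * boolSign (ω j) * (L / 2 * (1 + if i.1 = j then boolSign i.2 else 0)) =
      γ * boolSign (ω j) * (L / 2) +
        if i.1 = j then γ * boolSign (ω j) * (L / 2) * boolSign i.2 else 0 := by
    intro j; split_ifs <;> ring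
  simp only [h, Finset.sum_add_distrib, Finset.sum_ite_eq, Finset.mem_univ, if_true,
    ← Finset.sum_mul]
  ring

end Cube

theorem excessRisk_eq_risk {d n M : ℕ} {q : Fin M → Space d → ℝ}
    (T : (Fin n → Space d) → Space d → ℝ) {p : Space d → ℝ} {lam : Fin M → ℝ}
    (h : linComb q lam = p) : excessRisk q T p = (risk T p : EReal) := by
  have h0 : (⨅ lam : Fin M → ℝ, sqDist (linComb q lam) p) = 0 :=
    le_antisymm (iInf_le_of_le lam (by simp [h, sqDist])) bot_le
  simp [excessRisk, h0]

end DensityAggregation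

/-! ### Choice of constants and conclusion -/

theorem theorem3p1 (c₀ : ℝ) (hc₀ : 0 < c₀) :
    ∃ c : ℝ, 0 < c ∧
      ∀ (d : ℕ) (L : ℝ) (M n : ℕ), 1 ≤ d → 0 < L → 2 ≤ M → 1 ≤ n → (M : ℝ) ≤ c₀ * n →
        ∃ q : Fin M → DensityAggregation.Space d → ℝ,
          (∀ j, DensityAggregation.IsDensity (q j) ∧ MeasureTheory.MemLp (q j) 2) ∧
          ((c * L * M / n : ℝ) : EReal) ≤
            ⨅ (T : (Fin n → DensityAggregation.Space d) → DensityAggregation.Space d → ℝ)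
              (_ : DensityAggregation.IsEstimator T),
              ⨆ p ∈ DensityAggregation.boundedDensities d L,
                DensityAggregation.excessRisk q T p := by
  open DensityAggregation in
  refine ⟨1 / (32 * max 1 c₀), by positivity, ?_⟩
  intro d L M n hd hL hM hn hMn
  obtain ⟨K, rfl⟩ : ∃ K, M = K + 1 := ⟨M - 1, by omega⟩
  have hK : 1 ≤ K := by omega
  have hKr : (1 : ℝ) ≤ K := by exact_mod_cast hK
  have hnr : (1 : ℝ) ≤ n := by exact_mod_cast hn
  have hm1 : 1 ≤ max 1 c₀ := le_max_left _ _
  set m := max 1 c₀ with hm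
  have hw : 0 ≤ 1 / (L * K) := by positivity
  obtain ⟨A, hA, hvol, hdisj⟩ := exists_disjoint_cells hd (Fin K × Bool) hw
  have hnorm : 1 / (L * K) * (L * K) = 1 := one_div_mul_cancel (by positivity)
  refine ⟨fun j => step A (dictionaryValue L j), fun j =>
    ⟨isDensity_step hA hw hvol (dictionaryValue_nonneg hL.le j)
      (by rw [sum_dictionaryValue, hnorm]), memLp_step hA hvol _ _⟩, ?_⟩
  refine le_iInf₂ fun T hT => ?_
  -- In `m = max 1 c₀`, the bound `m ≥ c₀` ensures `γ ≤ 1`, and `m ≥ 1` ensures `nγ² ≤ K/4`.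
  obtain ⟨γ, hγ0, hγ⟩ : ∃ γ : ℝ, 0 ≤ γ ∧ γ ^ 2 = K / (4 * n * m) :=
    ⟨√(K / (4 * n * m)), Real.sqrt_nonneg _, Real.sq_sqrt (by positivity)⟩
  have hKm : (K : ℝ) ≤ n * m := by
    have : c₀ * n ≤ m * n := mul_le_mul_of_nonneg_right (le_max_right _ _) (by positivity)
    push_cast at hMn
    linarith
  have hγ1 : γ ≤ 1 := by
    have : γ ^ 2 ≤ 1 := by
      rw [hγ, div_le_one (by positivity)]; linarith
    nlinarith
  have hnγ : n * γ ^ 2 ≤ K / 4 := by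
    have e : n * γ ^ 2 = K / 4 / m := by rw [hγ]; field_simp
    rw [e]
    exact div_le_self (by positivity) hm1
  obtain ⟨ω, hω⟩ := exists_risk_ge hK hL hγ0 hγ1 hnγ hA hvol hdisj hT
  obtain ⟨lam, hlam⟩ := cubeValue_mem_span (L := L) (γ := γ) ω
  have hmem : step A (cubeValue L γ ω) ∈ boundedDensities d L :=
    step_mem_boundedDensities hA hdisj hw hvol (cubeValue_nonneg hL.le hγ0 hγ1 ω) hL.le
      (cubeValue_le hL.le hγ0 hγ1 ω) (by rw [sum_cubeValue, hnorm])
  refine le_iSup₂_of_le _ hmem ?_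
  rw [excessRisk_eq_risk T (lam := lam) (by
    funext x
    rw [linComb, sum_mul_step]
    exact congrArg (fun a => step A a x) (funext hlam))]
  -- The risk bound is `LK/(16nm)`; `M = K + 1 ≤ 2K` costs the remaining factor two.
  have hle : 1 / (32 * m) * L * ((K + 1 : ℕ) : ℝ) / n ≤ L * γ ^ 2 / 4 := by
    rw [hγ]
    have e : L * (K / (4 * n * m)) / 4 = 1 / (32 * m) * L * (2 * K) / n := by
      field_simp; ring
    rw [e]
    push_cast
    gcongr
    linarith
  calc ((1 / (32 * m) * L * ((K + 1 : ℕ) : ℝ) / n : ℝ) : EReal)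
      ≤ ((L * γ ^ 2 / 4 : ℝ) : EReal) := by exact_mod_cast hle
    _ = ((ENNReal.ofReal (L * γ ^ 2 / 4) : ℝ≥0∞) : EReal) := by
        rw [EReal.coe_ennreal_ofReal, max_eq_left (by positivity)]
    _ ≤ _ := by exact_mod_cast hω
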